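/- A monotone triangle with $n$ rows is an array of integers $(a_{i,j})_{1\le i\le j\le n}$ with $a_{i,j}\le a_{i+1,j+1}$ for $1\le i\le j<n$, $a_{i,j}\le a_{i-1,j}$ for $1<i\le j\le n$, and $a_{i,j}<a_{i,j+1}$ for $1\le i\le j<n$; its bottom row is $(a_{1,1},\dots,a_{1,n})$. Its $Q$-weight is $Q$ raised to the number of entries $a_{i,j}$ with $i\neq 1$ and $a_{i-1,j-1}<a_{i,j}<a_{i-1,j}$. An $n\times n$ alternating sign matrix (ASM) is an $n\times n$ matrix with entries in $\{0,1,-1\}$ in which all row and column sums are $1$ and the nonzero entries of each row and of each column alternate in sign; its $Q$-weight is $Q$ raised to the number of its entries $-1$. An ASM is vertically symmetric if it is invariant under reflection in its vertical axis; such a matrix of odd size is weighted by $Q$ raised to the number of its entries $-1$ strictly to the left of the middle column (equivalently, the number of orbits of entries $-1$ under the reflection, not counting the entries in the middle column, which are forced by the symmetry). The $2$-enumeration of a finite set of such objects is the sum of the weights at $Q=2$. 1. For all integers $k_1<k_2<\dots<k_n$ there are finitely many monotone triangles with bottom row $(k_1,\dots,k_n)$, and their $2$-enumeration is $$2^{\binom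 n2}\prod_{1\le i<j\le n}\frac{k_j-k_i}{j-i}.$$ 2. The $2$-enumeration of $n\times n$ ASMs is $2^{\binom n2}$. 3. For $1\le l\le n$, the $2$-enumeration of the $n\times n$ ASMs whose unique $1$ in the first row is in column $l$ is $2^{\binom{n-1}2}\binom{n-1}{l-1}$. 4. For $n\ge 1$, the $2$-enumeration of $(2n-1)\times(2n-1)$ vertically symmetric ASMs is $2^{(n-1)(n-2)}$. -/

import Mathlib

/-- `a` is a monotone triangle with `n` rows: the entries are `a i j` for `1 ≤ i ≤ j ≤ n`,
where row `i = 1` is the bottom row and row `i = n` is the top row.  The values of `a` outside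
the triangle carry no information and are normalized to `0`. -/
structure IsMonotoneTriangle (n : ℕ) (a : ℕ → ℕ → ℤ) : Prop where
  northeast : ∀ i j : ℕ, 1 ≤ i → i ≤ j → j < n → a i j ≤ a (i + 1) (j + 1)
  southeast : ∀ i j : ℕ, 1 < i → i ≤ j → j ≤ n → a i j ≤ a (i - 1) j
  row_strict : ∀ i j : ℕ, 1 ≤ i → i ≤ j → j < n → a i j < a i (j + 1)
  outside : ∀ i j : ℕ, ¬ (1 ≤ i ∧ i ≤ j ∧ j ≤ n) → a i j = 0

/-- The monotone triangles with bottom row `(k 0, …, k (n - 1))`. -/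
def monotoneTriangles (n : ℕ) (k : Fin n → ℤ) : Set (ℕ → ℕ → ℤ) :=
  {a | IsMonotoneTriangle n a ∧ ∀ j : Fin n, a 1 ((j : ℕ) + 1) = k j}

/-- The number of entries `a i j` that are not in the bottom row and lie strictly between their
two neighbours in the row below. -/
def strictEntryCount (n : ℕ) (a : ℕ → ℕ → ℤ) : ℕ :=
  ((Finset.Icc 1 n ×ˢ Finset.Icc 1 n).filter (fun p : ℕ × ℕ =>
    1 < p.1 ∧ p.1 ≤ p.2 ∧
      a (p.1 - 1) (p.2 - 1) < a p.1 p.2 ∧ a p.1 p.2 < a (p.1 - 1) p.2)).card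

/-- The `Q`-enumeration of the monotone triangles with bottom row `k`. -/
noncomputable def monotoneTriangleEnum {R : Type*} [CommSemiring R] (Q : R) (n : ℕ)
    (k : Fin n → ℤ) : R :=
  ∑ᶠ a ∈ monotoneTriangles n k, Q ^ strictEntryCount n a

/-- The nonzero terms of the finite sequence `v` alternate in sign (for entries `0, 1, -1`). -/
def AlternatesInSign {n : ℕ} (v : Fin n → ℤ) : Prop :=
  ∀ i j : Fin n, i < j → v i ≠ 0 → v j ≠ 0 → (∀ m : Fin n, i < m → m < j → v m = 0) →
    v j = -v i

/-- Alternating sign matrices of size `n × n`. -/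
structure IsASM {n : ℕ} (A : Matrix (Fin n) (Fin n) ℤ) : Prop where
  entries : ∀ i j, A i j = 0 ∨ A i j = 1 ∨ A i j = -1
  row_sum : ∀ i, ∑ j, A i j = 1
  col_sum : ∀ j, ∑ i, A i j = 1
  row_alt : ∀ i, AlternatesInSign (fun j => A i j)
  col_alt : ∀ j, AlternatesInSign (fun i => A i j)

/-- The number of entries `-1` of `A`. -/
def negOneCount {n : ℕ} (A : Matrix (Fin n) (Fin n) ℤ) : ℕ :=
  (Finset.univ.filter (fun p : Fin n × Fin n => A p.1 p.2 = -1)).card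

/-- The `Q`-enumeration of a set of matrices with respect to the number of entries `-1`. -/
noncomputable def negOneEnum {R : Type*} [CommSemiring R] (Q : R) {n : ℕ}
    (S : Set (Matrix (Fin n) (Fin n) ℤ)) : R :=
  ∑ᶠ A ∈ S, Q ^ negOneCount A

/-- Vertically symmetric alternating sign matrices: invariant under reflection in the vertical
axis. -/
structure IsVSASM {n : ℕ} (A : Matrix (Fin n) (Fin n) ℤ) : Prop where
  isASM : IsASM A
  symm : ∀ i j, A i j.rev = A i j

/-- The number of entries `-1` of `A` strictly to the left of the vertical symmetry axis.  For a
vertically symmetric matrix this is the number of reflection orbits of entries `-1`, where the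
entries on the axis, which are forced by the symmetry, are not counted. -/
def leftNegOneCount {n : ℕ} (A : Matrix (Fin n) (Fin n) ℤ) : ℕ :=
  (Finset.univ.filter (fun p : Fin n × Fin n => p.2 < p.2.rev ∧ A p.1 p.2 = -1)).card

/-- The `Q`-enumeration of the vertically symmetric alternating sign matrices of size `n × n`. -/
noncomputable def vsasmEnum {R : Type*} [CommSemiring R] (Q : R) (n : ℕ) : R :=
  ∑ᶠ A ∈ {A : Matrix (Fin n) (Fin n) ℤ | IsVSASM A}, Q ^ leftNegOneCount A

/-!
The rows of a monotone triangle above its bottom row `k` form a monotone triangle whose bottom row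
interlaces with `k`, so the enumeration satisfies a recursion over interlacing sequences. At `Q = 2`
an interior summand counts twice and an end point once, so that summing a difference
`g (x + 1) - g x` telescopes to a difference of values of `g x + g (x + 1)`. Applied to the rows of
a Vandermonde determinant this gives the Vandermonde determinant of `k` up to a constant, because
`X ^ j + (X + 1) ^ j` has leading coefficient `2`.

The sum of the lower `m` rows of an alternating sign matrix is a vector of zeros and `m` ones, and
the positions of these ones, as `m` varies, form the rows of a monotone triangle; the entries `-1`
become the entries strictly between their neighbours. All alternating sign matrices correspond in
this way to the bottom row `0, 1, …, n - 1`, those with a prescribed `1` in the first row to the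
same sequence with one term deleted. In a vertically symmetric matrix the middle column is
`1, -1, …, 1`, so the columns to the right of it, written as rows, correspond to the bottom row
`1, 3, 5, …`.
-/

section Determinants

open Polynomial Matrix

variable {R : Type*} [CommRing R] {n : ℕ}

theorem prod_prod_Ioi_succAbove {M : Type*} [CommMonoid M] (f : Fin (n + 1) → Fin (n + 1) → M)
    (p : Fin (n + 1)) :
    ∏ i, ∏ j ∈ Finset.Ioi i, f i j =
      (∏ i ∈ Finset.Iio p, f i p) * (∏ j ∈ Finset.Ioi p, f p j) *
        ∏ i, ∏ j ∈ Finset.Ioi i, f (p.succAbove i) (p.succAbove j) := by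
  simp only [← Finset.filter_lt_eq_Ioi, ← Finset.filter_gt_eq_Iio, Finset.prod_filter,
    Fin.prod_univ_succAbove _ p, Finset.prod_mul_distrib, lt_irrefl, if_false, one_mul,
    Fin.succAbove_lt_succAbove_iff]
  rw [← mul_assoc, mul_comm (∏ i, _)]

theorem det_eval_eq_prod_coeff_mul_det_vandermonde (v : Fin n → R) (p : Fin n → R[X])
    (hp : ∀ j, (p j).natDegree ≤ j) :
    (of fun i j => (p j).eval (v i)).det = (∏ j, (p j).coeff j) * (vandermonde v).det := by
  rw [eval_matrixOfPolynomials_eq_vandermonde_mul_matrixOfPolynomials v p hp, det_mul, mul_comm,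
    det_of_isUpperTriangular (matrixOfPolynomials_blockTriangular p hp)]
  rfl

theorem det_pow_add_add_one_pow (v : Fin n → R) :
    (of fun i j : Fin n => v i ^ (j : ℕ) + (v i + 1) ^ (j : ℕ)).det =
      2 ^ n * (vandermonde v).det := by
  have hcoeff (j : Fin n) : (X ^ (j : ℕ) + (X + 1) ^ (j : ℕ) : R[X]).coeff j = 2 := by
    simp [coeff_X_add_one_pow, one_add_one_eq_two]
  have hdeg (j : Fin n) : (X ^ (j : ℕ) + (X + 1) ^ (j : ℕ) : R[X]).natDegree ≤ j := by
    compute_degree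
  simpa [hcoeff] using det_eval_eq_prod_coeff_mul_det_vandermonde v _ hdeg

theorem det_add_one_pow_sub_pow (v : Fin n → R) :
    (of fun i j : Fin n => (v i + 1) ^ (j + 1 : ℕ) - v i ^ (j + 1 : ℕ)).det =
      n.factorial * (vandermonde v).det := by
  let p (j : ℕ) : R[X] := (X + 1) ^ (j + 1) - X ^ (j + 1)
  have hcoeff (j : ℕ) : (p j).coeff j = j + 1 := by
    simp [p, coeff_X_add_one_pow, coeff_X_pow]
  have hdeg (j : ℕ) : (p j).natDegree ≤ j := by
    refine natDegree_le_iff_coeff_eq_zero.2 fun N hN => ?_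
    rcases (Nat.succ_le_of_lt hN).eq_or_lt with rfl | hN
    · simp [p, coeff_X_add_one_pow]
    · simp [p, coeff_X_add_one_pow, coeff_X_pow, Nat.choose_eq_zero_of_lt hN, hN.ne']
  have hprod : ∏ j : Fin n, (p j).coeff j = n.factorial := by
    simp only [hcoeff]
    rw [Fin.prod_univ_eq_prod_range (fun j => (j + 1 : R)),
      ← Finset.prod_range_add_one_eq_factorial]
    push_cast
    rfl
  simpa [p, ← hprod] using
    det_eval_eq_prod_coeff_mul_det_vandermonde v (fun j : Fin n => p j) fun j => hdeg j

theorem det_vandermonde_const_mul (c : R) (v : Fin n → R) :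
    (vandermonde fun i => c * v i).det = c ^ n.choose 2 * (vandermonde v).det := by
  calc (vandermonde fun i => c * v i).det
      = (of fun i j : Fin n => c ^ (j : ℕ) * vandermonde v i j).det := by
        congr 1
        ext i j
        exact mul_pow c (v i) j
    _ = c ^ n.choose 2 * (vandermonde v).det := by
        rw [det_mul_row, Fin.prod_univ_eq_prod_range (fun j => c ^ j), Finset.prod_pow_eq_pow_sum,
          Finset.sum_range_id, Nat.choose_two_right]

theorem det_of_column_zero_eq_const (M : Matrix (Fin (n + 1)) (Fin (n + 1)) R) {c : R}
    (hM : ∀ i, M i 0 = c) :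
    M.det = c * (of fun i j : Fin n => M i.succ j.succ - M i.castSucc j.succ).det := by
  let N : Matrix (Fin (n + 1)) (Fin (n + 1)) R :=
    of (Fin.cons (M 0) fun i j => M i.succ j - M i.castSucc j)
  have hMN : M.det = N.det :=
    det_eq_of_forall_row_eq_smul_add_pred (fun _ => 1) (fun j => by simp [N])
      (fun i j => by simp [N])
  have hN (i : Fin n) : N i.succ 0 = 0 := by simp [N, hM]
  rw [hMN, det_succ_column_zero, Fin.sum_univ_succ]
  simp only [hN, mul_zero, zero_mul, Finset.sum_const_zero, add_zero]
  simp only [Fin.val_zero, pow_zero, one_mul, N, of_apply, Fin.cons_zero, hM]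
  rfl

theorem sum_piFinset_prod_mul_det (s : Fin n → Finset ℤ) (w : Fin n → ℤ → R)
    (f : Fin n → ℤ → R) :
    ∑ l ∈ Fintype.piFinset s, (∏ i, w i (l i)) * (of fun i j => f j (l i)).det =
      (of fun i j => ∑ x ∈ s i, w i x * f j x).det := by
  have hexpand := (detRowAlternating (n := Fin n) (R := R)).toMultilinearMap.map_sum_finset
    (fun i x j => w i x * f j x) s
  simp only [← det_mul_column]
  refine hexpand.symm.trans (congrArg Matrix.det ?_)
  ext i j
  simp [Finset.sum_apply]

theorem det_vandermonde_eq_prod_mul_det_vandermonde_succAbove (v : Fin (n + 1) → R)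
    (p : Fin (n + 1)) :
    (vandermonde v).det = (∏ i ∈ Finset.Iio p, (v p - v i)) * (∏ j ∈ Finset.Ioi p, (v j - v p)) *
      (vandermonde (v ∘ p.succAbove)).det := by
  simp only [det_vandermonde]
  exact prod_prod_Ioi_succAbove (fun i j => v j - v i) p

theorem prod_Iio_val_sub_val (p : Fin n) :
    ∏ i ∈ Finset.Iio p, ((p : R) - i) = (p : ℕ).factorial := by
  calc ∏ i ∈ Finset.Iio p, ((p : R) - i)
      = ∏ i ∈ Finset.range p, ((p : R) - i) := by
        rw [← Nat.Iio_eq_range, ← Fin.map_valEmbedding_Iio, Finset.prod_map]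
        rfl
    _ = (p : ℕ).factorial := by
        rw [← Nat.descFactorial_self, Nat.descFactorial_eq_prod_range, Nat.cast_prod]
        exact Finset.prod_congr rfl fun i hi => (Nat.cast_sub (Finset.mem_range.1 hi).le).symm

theorem prod_Ioi_val_sub_val (p : Fin (n + 1)) :
    ∏ j ∈ Finset.Ioi p, ((j : R) - p) = (n - p : ℕ).factorial := by
  calc ∏ j ∈ Finset.Ioi p, ((j : R) - p)
      = ∏ j ∈ Finset.Ico (p + 1 : ℕ) (n + 1), ((j : R) - p) := by
        rw [Finset.Ico_add_one_left_eq_Ioo, ← Fin.map_valEmbedding_Ioi, Finset.prod_map]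
        rfl
    _ = (n - p : ℕ).factorial := by
        rw [Finset.prod_Ico_eq_prod_range, Nat.add_sub_add_right,
          ← Finset.prod_range_add_one_eq_factorial, Nat.cast_prod]
        exact Finset.prod_congr rfl fun i _ => by push_cast; ring

theorem det_vandermonde_val_eq_factorial_mul_succAbove (p : Fin (n + 1)) :
    (vandermonde fun i : Fin (n + 1) => (i : R)).det =
      (p : ℕ).factorial * (n - p : ℕ).factorial *
        (vandermonde fun i : Fin n => (p.succAbove i : R)).det := by
  rw [det_vandermonde_eq_prod_mul_det_vandermonde_succAbove _ p, prod_Iio_val_sub_val,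
    prod_Ioi_val_sub_val]
  rfl

end Determinants

section Interlacing

open Matrix

theorem sum_Icc_trapezoid {R : Type*} [CommRing R] (g : ℤ → R) {a b : ℤ} (hab : a < b) :
    ∑ x ∈ Finset.Icc a b, (if a < x ∧ x < b then 2 else 1) * (g (x + 1) - g x) =
      (g b + g (b + 1)) - (g a + g (a + 1)) := by
  have htelescope {c d : ℤ} (hcd : c ≤ d) :
      ∑ x ∈ Finset.Ico c d, (g (x + 1) - g x) = g d - g c := by
    induction d, hcd using Int.leInduction with
    | base => simp
    | succ d hcd ih =>
      rw [← Finset.insert_Ico_right_eq_Ico_add_one hcd, Finset.sum_insert (by simp), ih]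
      ring
  have hsplit : ∑ x ∈ Finset.Icc a b, (if a < x ∧ x < b then 2 else 1) * (g (x + 1) - g x) =
      ∑ x ∈ Finset.Ico a b, (g (x + 1) - g x) +
        ∑ x ∈ Finset.Ico (a + 1) (b + 1), (g (x + 1) - g x) := by
    have hIco : Finset.Ico a b = {x ∈ Finset.Icc a b | x < b} := by ext; grind
    have hIco' : Finset.Ico (a + 1) (b + 1) = {x ∈ Finset.Icc a b | a < x} := by ext; grind
    rw [hIco, hIco', Finset.sum_filter, Finset.sum_filter, ← Finset.sum_add_distrib]
    refine Finset.sum_congr rfl fun x hx => ?_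
    rw [Finset.mem_Icc] at hx
    grind
  rw [hsplit, htelescope hab.le, htelescope (by omega)]
  ring

variable {n : ℕ} {k : Fin (n + 1) → ℤ} {l : Fin n → ℤ}

/-- The strictly increasing integer sequences that can stand directly above the row `k` of a
monotone triangle. -/
noncomputable def interlacing (k : Fin (n + 1) → ℤ) : Finset (Fin n → ℤ) :=
  open Classical in
  {l ∈ Fintype.piFinset fun i : Fin n => Finset.Icc (k i.castSucc) (k i.succ) | StrictMono l}

theorem mem_interlacing :
    l ∈ interlacing k ↔ (∀ i, k i.castSucc ≤ l i ∧ l i ≤ k i.succ) ∧ StrictMono l := by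
  simp [interlacing, Fintype.mem_piFinset]

theorem strictMono_of_mem_interlacing (hl : l ∈ interlacing k) : StrictMono l :=
  (mem_interlacing.1 hl).2

/-- The number of entries of `l` lying strictly between their neighbours in the row `k` below: the
contribution of the row `l` to the exponent of the weight of a monotone triangle. -/
def strictCount (k : Fin (n + 1) → ℤ) (l : Fin n → ℤ) : ℕ :=
  Finset.card {i : Fin n | k i.castSucc < l i ∧ l i < k i.succ}

/-- A sequence in the box that is not strictly increasing repeats an entry, so its Vandermonde
determinant vanishes. -/
theorem sum_interlacing_mul_det_vandermonde (hk : StrictMono k) (c : (Fin n → ℤ) → ℤ) :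
    ∑ l ∈ interlacing k, c l * (vandermonde l).det =
      ∑ l ∈ Fintype.piFinset fun i : Fin n => Finset.Icc (k i.castSucc) (k i.succ),
        c l * (vandermonde l).det := by
  classical
  refine Finset.sum_filter_of_ne fun l hl hne => ?_
  have hbox (i : Fin n) : k i.castSucc ≤ l i ∧ l i ≤ k i.succ :=
    Finset.mem_Icc.1 (Fintype.mem_piFinset.1 hl i)
  have hmono : Monotone l := monotone_iff_forall_lt.2 fun i j hij =>
    (hbox i).2.trans ((hk.monotone (Fin.succ_le_castSucc_iff.2 hij)).trans (hbox j).1)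
  exact hmono.strictMono_of_injective (det_vandermonde_ne_zero_iff.1 (right_ne_zero_of_mul hne))

/-- Twice either side is the determinant of the matrix with entries `k i ^ j + (k i + 1) ^ j`: its
first column is constant, and the difference of two consecutive rows is a trapezoidal sum of the
polynomials `(x + 1) ^ j - x ^ j`. -/
theorem factorial_mul_sum_interlacing_two_pow_mul_det_vandermonde (hk : StrictMono k) :
    n.factorial * ∑ l ∈ interlacing k, 2 ^ strictCount k l * (vandermonde l).det =
      2 ^ n * (vandermonde k).det := by
  let w (i : Fin n) (x : ℤ) : ℤ := if k i.castSucc < x ∧ x < k i.succ then 2 else 1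
  have hweight (l : Fin n → ℤ) : (2 : ℤ) ^ strictCount k l = ∏ i, w i (l i) := by
    simp [w, strictCount, Finset.prod_ite]
  suffices h : 2 * (n.factorial *
      ∑ l ∈ interlacing k, 2 ^ strictCount k l * (vandermonde l).det) =
      2 * (2 ^ n * (vandermonde k).det) from mul_left_cancel₀ two_ne_zero h
  calc 2 * (n.factorial * ∑ l ∈ interlacing k, 2 ^ strictCount k l * (vandermonde l).det)
      = 2 * ∑ l ∈ Fintype.piFinset fun i : Fin n => Finset.Icc (k i.castSucc) (k i.succ),
          (∏ i, w i (l i)) *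
            (of fun i j : Fin n => (l i + 1) ^ (j + 1 : ℕ) - l i ^ (j + 1 : ℕ)).det := by
        rw [sum_interlacing_mul_det_vandermonde hk, Finset.mul_sum]
        simp only [hweight, det_add_one_pow_sub_pow, mul_left_comm]
    _ = 2 * (of fun i j : Fin n => ∑ x ∈ Finset.Icc (k i.castSucc) (k i.succ),
          w i x * ((x + 1) ^ (j + 1 : ℕ) - x ^ (j + 1 : ℕ))).det := by
        rw [← sum_piFinset_prod_mul_det _ w fun j x => (x + 1) ^ (j + 1 : ℕ) - x ^ (j + 1 : ℕ)]
    _ = (of fun i j : Fin (n + 1) => k i ^ (j : ℕ) + (k i + 1) ^ (j : ℕ)).det := by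
        rw [det_of_column_zero_eq_const _ (c := 2) (by simp [one_add_one_eq_two])]
        congr 2
        ext i j
        exact sum_Icc_trapezoid (fun x => x ^ (j + 1 : ℕ)) (hk Fin.castSucc_lt_succ)
    _ = 2 * (2 ^ n * (vandermonde k).det) := by
        rw [det_pow_add_add_one_pow, pow_succ']
        ring

end Interlacing

theorem finsum_mem_biUnion_image_of_leftInverse {α β ι M : Type*} [AddCommMonoid M]
    {I : Finset ι} {T : ι → Set α} {φ : ι → α → β} {δ : β → α}
    (hfin : ∀ l ∈ I, (T l).Finite) (hdisj : (I : Set ι).PairwiseDisjoint T)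
    (hδ : ∀ l ∈ I, ∀ a ∈ T l, δ (φ l a) = a) (f : β → M) :
    ∑ᶠ b ∈ ⋃ l ∈ I, φ l '' T l, f b = ∑ l ∈ I, ∑ᶠ a ∈ T l, f (φ l a) := by
  have hdisj' : (I : Set ι).PairwiseDisjoint fun l => φ l '' T l := by
    intro l hl l' hl' hne
    refine Set.disjoint_left.2 ?_
    rintro _ ⟨a, ha, rfl⟩ ⟨a', ha', h⟩
    have haa' : a' = a := by rw [← hδ l' hl' a' ha', h, hδ l hl a ha]
    exact Set.disjoint_left.1 (hdisj hl hl' hne) ha (haa' ▸ ha')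
  refine (finsum_mem_biUnion hdisj' I.finite_toSet fun l hl => (hfin l hl).image _).trans ?_
  rw [finsum_mem_coe_finset]
  refine Finset.sum_congr rfl fun l hl => finsum_mem_image fun a ha a' ha' h => ?_
  rw [← hδ l hl a ha, h, hδ l hl a' ha']

section MonotoneTriangles

open Matrix

variable {n : ℕ}

/-- The triangle formed by all the rows of `a` except the bottom one. -/
def dropBottomRow (a : ℕ → ℕ → ℤ) : ℕ → ℕ → ℤ
  | 0, _ => 0
  | i + 1, j => a (i + 2) (j + 1)

/-- The triangle with bottom row `k` whose other rows form the triangle `b`. -/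
def addBottomRow (k : Fin n → ℤ) (b : ℕ → ℕ → ℤ) : ℕ → ℕ → ℤ
  | 0, _ => 0
  | _ + 1, 0 => 0
  | 1, j + 1 => if h : j < n then k ⟨j, h⟩ else 0
  | i + 2, j + 1 => b (i + 1) j

theorem dropBottomRow_addBottomRow (k : Fin (n + 1) → ℤ) {l : Fin n → ℤ} {b : ℕ → ℕ → ℤ}
    (hb : b ∈ monotoneTriangles n l) : dropBottomRow (addBottomRow k b) = b := by
  funext i j
  rcases i with _ | i
  · exact (hb.1.outside 0 j (by omega)).symm
  · rfl

theorem addBottomRow_dropBottomRow {k : Fin n → ℤ} {a : ℕ → ℕ → ℤ}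
    (ha : a ∈ monotoneTriangles n k) : addBottomRow k (dropBottomRow a) = a := by
  funext i j
  rcases i with _ | _ | i <;> rcases j with _ | j
  · exact (ha.1.outside 0 0 (by omega)).symm
  · exact (ha.1.outside 0 (j + 1) (by omega)).symm
  · exact (ha.1.outside 1 0 (by omega)).symm
  · simp only [addBottomRow]
    split_ifs with hj
    · exact (ha.2 ⟨j, hj⟩).symm
    · exact (ha.1.outside 1 (j + 1) (by omega)).symm
  · exact (ha.1.outside (i + 2) 0 (by omega)).symm
  · rfl

theorem dropBottomRow_mem_monotoneTriangles {k : Fin (n + 1) → ℤ} {a : ℕ → ℕ → ℤ}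
    (ha : a ∈ monotoneTriangles (n + 1) k) :
    dropBottomRow a ∈ monotoneTriangles n fun j => a 2 (j + 2) := by
  refine ⟨⟨?_, ?_, ?_, ?_⟩, fun j => rfl⟩
  · rintro (_ | i) j hi hij hj
    · omega
    · exact ha.1.northeast (i + 2) (j + 1) (by omega) (by omega) (by omega)
  · rintro (_ | _ | i) j hi hij hj
    · omega
    · omega
    · exact ha.1.southeast (i + 3) (j + 1) (by omega) (by omega) (by omega)
  · rintro (_ | i) j hi hij hj
    · omega
    · exact ha.1.row_strict (i + 2) (j + 1) (by omega) (by omega) (by omega)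
  · rintro (_ | i) j hij
    · rfl
    · exact ha.1.outside (i + 2) (j + 1) (by omega)

theorem strictMono_of_mem_monotoneTriangles {k : Fin n → ℤ} {a : ℕ → ℕ → ℤ}
    (ha : a ∈ monotoneTriangles n k) : StrictMono k := by
  rcases n with _ | n
  · exact fun i => i.elim0
  · refine Fin.strictMono_iff_lt_succ.2 fun i => ?_
    rw [← ha.2, ← ha.2]
    exact ha.1.row_strict 1 (i + 1) (by omega) (by omega) (by omega)

theorem secondRow_mem_interlacing {k : Fin (n + 1) → ℤ} {a : ℕ → ℕ → ℤ}
    (ha : a ∈ monotoneTriangles (n + 1) k) : (fun j : Fin n => a 2 (j + 2)) ∈ interlacing k := by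
  refine mem_interlacing.2 ⟨fun j => ?_,
    strictMono_of_mem_monotoneTriangles (dropBottomRow_mem_monotoneTriangles ha)⟩
  rw [← ha.2, ← ha.2]
  exact ⟨ha.1.northeast 1 (j + 1) (by omega) (by omega) (by omega),
    ha.1.southeast 2 (j + 2) (by omega) (by omega) (by omega)⟩

theorem addBottomRow_mem_monotoneTriangles {k : Fin (n + 1) → ℤ} (hk : StrictMono k)
    {l : Fin n → ℤ} (hl : l ∈ interlacing k) {b : ℕ → ℕ → ℤ} (hb : b ∈ monotoneTriangles n l) :
    addBottomRow k b ∈ monotoneTriangles (n + 1) k := by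
  have hbounds := (mem_interlacing.1 hl).1
  refine ⟨⟨?_, ?_, ?_, ?_⟩, fun j => dif_pos j.isLt⟩
  · rintro (_ | _ | i) (_ | j) hi hij hj <;> try omega
    · simp only [addBottomRow, dif_pos (show j < n + 1 by omega)]
      exact (hbounds ⟨j, by omega⟩).1.trans_eq (hb.2 ⟨j, by omega⟩).symm
    · exact hb.1.northeast (i + 1) j (by omega) (by omega) (by omega)
  · rintro (_ | _ | _ | i) (_ | _ | j) hi hij hj <;> try omega
    · simp only [addBottomRow, Nat.add_one_sub_one, dif_pos (show j + 1 < n + 1 by omega)]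
      exact (hb.2 ⟨j, by omega⟩).trans_le (hbounds ⟨j, by omega⟩).2
    · exact hb.1.southeast (i + 2) (j + 1) (by omega) (by omega) (by omega)
  · rintro (_ | _ | i) (_ | j) hi hij hj <;> try omega
    · simp only [addBottomRow, dif_pos (show j < n + 1 by omega),
        dif_pos (show j + 1 < n + 1 by omega)]
      exact hk (Fin.mk_lt_mk.2 j.lt_succ_self)
    · exact hb.1.row_strict (i + 1) j (by omega) (by omega) (by omega)
  · rintro (_ | _ | i) (_ | j) hij
    · rfl
    · rfl
    · rfl
    · exact dif_neg (by omega)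
    · rfl
    · exact hb.1.outside (i + 1) j (by omega)

theorem monotoneTriangles_succ {k : Fin (n + 1) → ℤ} (hk : StrictMono k) :
    monotoneTriangles (n + 1) k =
      ⋃ l ∈ interlacing k, addBottomRow k '' monotoneTriangles n l := by
  ext a
  simp only [Set.mem_iUnion, Set.mem_image]
  constructor
  · exact fun ha => ⟨_, secondRow_mem_interlacing ha, _, dropBottomRow_mem_monotoneTriangles ha,
      addBottomRow_dropBottomRow ha⟩
  · rintro ⟨l, hl, b, hb, rfl⟩
    exact addBottomRow_mem_monotoneTriangles hk hl hb

theorem monotoneTriangles_zero (k : Fin 0 → ℤ) : monotoneTriangles 0 k = {0} := by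
  refine Set.eq_singleton_iff_unique_mem.2 ⟨⟨⟨?_, ?_, ?_, fun _ _ _ => rfl⟩, fun j => j.elim0⟩,
    fun a ha => funext₂ fun i j => ha.1.outside i j (by omega)⟩
  all_goals intros; omega

theorem finite_monotoneTriangles (k : Fin n → ℤ) : (monotoneTriangles n k).Finite := by
  induction n with
  | zero => exact monotoneTriangles_zero k ▸ Set.finite_singleton 0
  | succ n ih =>
    refine Set.Finite.subset ((interlacing k).finite_toSet.biUnion fun l _ =>
      (ih l).image (addBottomRow k)) fun a ha => ?_
    rwa [monotoneTriangles_succ (strictMono_of_mem_monotoneTriangles ha)] at ha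

theorem pairwiseDisjoint_monotoneTriangles (s : Set (Fin n → ℤ)) :
    s.PairwiseDisjoint (monotoneTriangles n) :=
  fun _ _ _ _ hne => Set.disjoint_left.2 fun _ ha ha' =>
    hne (funext fun j => (ha.2 j).symm.trans (ha'.2 j))

theorem strictEntryCount_succ_eq_sum (a : ℕ → ℕ → ℤ) :
    strictEntryCount (n + 1) a = ∑ i ∈ Finset.range n, ∑ j ∈ Finset.range n,
      if i ≤ j ∧ a (i + 1) (j + 1) < a (i + 2) (j + 2) ∧ a (i + 2) (j + 2) < a (i + 1) (j + 2)
      then 1 else 0 := by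
  have hIcc (f : ℕ → ℕ) :
      ∑ i ∈ Finset.Icc 1 (n + 1), f i = ∑ i ∈ Finset.range n, f (i + 2) + f 1 := by
    rw [← Finset.sum_range_succ' (fun i => f (i + 1)), Finset.range_eq_Ico, Finset.sum_Ico_add']
    rfl
  rw [strictEntryCount, Finset.card_filter, Finset.sum_product, hIcc]
  simp [hIcc]

theorem strictEntryCount_addBottomRow (k : Fin (n + 1) → ℤ) {l : Fin n → ℤ} {b : ℕ → ℕ → ℤ}
    (hb : b ∈ monotoneTriangles n l) :
    strictEntryCount (n + 1) (addBottomRow k b) = strictCount k l + strictEntryCount n b := by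
  have hrow : strictCount k l = ∑ j ∈ Finset.range n,
      if addBottomRow k b 1 (j + 1) < b 1 (j + 1) ∧ b 1 (j + 1) < addBottomRow k b 1 (j + 2)
      then 1 else 0 := by
    rw [strictCount, Finset.card_filter, Finset.sum_range]
    refine Finset.sum_congr rfl fun j _ => ?_
    simp only [addBottomRow, hb.2 j, dif_pos (show (j : ℕ) < n + 1 by omega),
      dif_pos (show (j : ℕ) + 1 < n + 1 by omega)]
    rfl
  rw [hrow, strictEntryCount_succ_eq_sum]
  rcases n with _ | n
  · simp [strictEntryCount]
  · rw [strictEntryCount_succ_eq_sum, Finset.sum_range_succ', add_comm]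
    refine congrArg₂ (· + ·) (by simp [addBottomRow]) (Finset.sum_congr rfl fun i _ => ?_)
    rw [Finset.sum_range_succ']
    simp [addBottomRow]

variable {R S : Type*} [CommSemiring R] [CommSemiring S]

theorem monotoneTriangleEnum_zero (Q : R) (k : Fin 0 → ℤ) : monotoneTriangleEnum Q 0 k = 1 := by
  simp [monotoneTriangleEnum, monotoneTriangles_zero, strictEntryCount]

theorem monotoneTriangleEnum_succ (Q : R) {k : Fin (n + 1) → ℤ} (hk : StrictMono k) :
    monotoneTriangleEnum Q (n + 1) k =
      ∑ l ∈ interlacing k, Q ^ strictCount k l * monotoneTriangleEnum Q n l := by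
  rw [monotoneTriangleEnum, monotoneTriangles_succ hk,
    finsum_mem_biUnion_image_of_leftInverse (fun l _ => finite_monotoneTriangles l)
      (pairwiseDisjoint_monotoneTriangles _) fun l _ b hb => dropBottomRow_addBottomRow k hb]
  refine Finset.sum_congr rfl fun l _ => ?_
  rw [monotoneTriangleEnum, mul_finsum_mem' _ _ (finite_monotoneTriangles l)]
  exact finsum_mem_congr rfl fun b hb => by rw [strictEntryCount_addBottomRow k hb, pow_add]

theorem map_monotoneTriangleEnum (f : R →+* S) (Q : R) (k : Fin n → ℤ) :
    f (monotoneTriangleEnum Q n k) = monotoneTriangleEnum (f Q) n k := by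
  simp only [monotoneTriangleEnum, ← map_pow]
  exact f.toAddMonoidHom.map_finsum_mem _ (finite_monotoneTriangles k)

/-- The Vandermonde determinant of `0, …, n` is `n !` times that of `0, …, n - 1`, which matches the
factor in the recursion over interlacing sequences. -/
theorem det_vandermonde_val_mul_monotoneTriangleEnum_two {k : Fin n → ℤ} (hk : StrictMono k) :
    (vandermonde fun i : Fin n => (i : ℤ)).det * monotoneTriangleEnum (2 : ℤ) n k =
      2 ^ n.choose 2 * (vandermonde k).det := by
  induction n with
  | zero => simp [monotoneTriangleEnum_zero]
  | succ n ih =>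
    have hval : (vandermonde fun i : Fin (n + 1) => (i : ℤ)).det =
        n.factorial * (vandermonde fun i : Fin n => (i : ℤ)).det := by
      simpa using det_vandermonde_val_eq_factorial_mul_succAbove (R := ℤ) (Fin.last n)
    calc (vandermonde fun i : Fin (n + 1) => (i : ℤ)).det * monotoneTriangleEnum 2 (n + 1) k
        = n.factorial * ∑ l ∈ interlacing k, 2 ^ strictCount k l *
            ((vandermonde fun i : Fin n => (i : ℤ)).det * monotoneTriangleEnum 2 n l) := by
          rw [hval, monotoneTriangleEnum_succ _ hk, mul_assoc, Finset.mul_sum]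
          simp only [mul_left_comm]
      _ = 2 ^ n.choose 2 *
            (n.factorial * ∑ l ∈ interlacing k, 2 ^ strictCount k l * (vandermonde l).det) := by
          simp only [Finset.mul_sum]
          refine Finset.sum_congr rfl fun l hl => ?_
          rw [ih (strictMono_of_mem_interlacing hl)]
          ring
      _ = 2 ^ (n + 1).choose 2 * (vandermonde k).det := by
          rw [factorial_mul_sum_interlacing_two_pow_mul_det_vandermonde hk, ← mul_assoc, ← pow_add,
            Nat.choose_succ_succ' n 1, Nat.choose_one_right, add_comm]

theorem det_vandermonde_val_ne_zero : (vandermonde fun i : Fin n => (i : ℤ)).det ≠ 0 :=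
  det_vandermonde_ne_zero_iff.2 fun _ _ h => Fin.ext (Nat.cast_injective (R := ℤ) h)

theorem monotoneTriangleEnum_two_eq_prod {K : Type*} [Field K] [CharZero K] {k : Fin n → ℤ}
    (hk : StrictMono k) :
    monotoneTriangleEnum (2 : K) n k = 2 ^ n.choose 2 *
      ∏ i : Fin n, ∏ j ∈ Finset.Ioi i, ((k j : K) - k i) / ((j : K) - (i : K)) := by
  have hcast : monotoneTriangleEnum (2 : K) n k = (monotoneTriangleEnum (2 : ℤ) n k : ℤ) := by
    simpa using (map_monotoneTriangleEnum (Int.castRingHom K) 2 k).symm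
  have hne : ((vandermonde fun i : Fin n => (i : ℤ)).det : K) ≠ 0 :=
    Int.cast_ne_zero.2 det_vandermonde_val_ne_zero
  have hmul : ((vandermonde fun i : Fin n => (i : ℤ)).det : K) * monotoneTriangleEnum 2 n k =
      2 ^ n.choose 2 * (vandermonde k).det := by
    rw [hcast]
    exact_mod_cast det_vandermonde_val_mul_monotoneTriangleEnum_two hk
  rw [eq_div_of_mul_eq hne ((mul_comm _ _).trans hmul), mul_div_assoc]
  simp [det_vandermonde, Finset.prod_div_distrib]

theorem det_vandermonde_val_mul_natCast_monotoneTriangleEnum_two {k : Fin n → ℤ}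
    (hk : StrictMono k) :
    (vandermonde fun i : Fin n => (i : ℤ)).det * (monotoneTriangleEnum (2 : ℕ) n k : ℕ) =
      2 ^ n.choose 2 * (vandermonde k).det := by
  rw [← det_vandermonde_val_mul_monotoneTriangleEnum_two hk]
  exact congrArg _ (map_monotoneTriangleEnum (Nat.castRingHom ℤ) 2 k)

theorem strictMono_val_succAbove (p : Fin (n + 1)) :
    StrictMono fun i : Fin n => ((p.succAbove i : ℕ) : ℤ) :=
  (Nat.strictMono_cast.comp Fin.val_strictMono).comp p.strictMono_succAbove

theorem strictMono_val : StrictMono fun i : Fin n => ((i : ℕ) : ℤ) :=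
  Nat.strictMono_cast.comp Fin.val_strictMono

theorem strictMono_two_mul_val_add_one : StrictMono fun i : Fin n => (2 * (i : ℕ) + 1 : ℤ) :=
  fun i j hij => by have := Fin.lt_def.1 hij; dsimp only; omega

theorem monotoneTriangleEnum_two_val :
    monotoneTriangleEnum (2 : ℕ) n (fun i => (i : ℕ)) = 2 ^ n.choose 2 := by
  have h := det_vandermonde_val_mul_natCast_monotoneTriangleEnum_two (strictMono_val (n := n))
  rw [mul_comm (2 ^ _)] at h
  exact_mod_cast mul_left_cancel₀ det_vandermonde_val_ne_zero h

theorem monotoneTriangleEnum_two_val_succAbove (p : Fin (n + 1)) :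
    monotoneTriangleEnum (2 : ℕ) n (fun i => (p.succAbove i : ℕ)) =
      2 ^ n.choose 2 * n.choose p := by
  have henum :=
    det_vandermonde_val_mul_natCast_monotoneTriangleEnum_two (strictMono_val_succAbove p)
  have hdelete := (det_vandermonde_val_eq_factorial_mul_succAbove (R := ℤ) (Fin.last n)).symm.trans
    (det_vandermonde_val_eq_factorial_mul_succAbove p)
  have hchoose : (n.choose p * (p : ℕ).factorial * (n - p : ℕ).factorial : ℤ) = n.factorial :=
    mod_cast Nat.choose_mul_factorial_mul_factorial p.is_le
  simp only [Fin.val_last, tsub_self, Nat.factorial_zero, Nat.cast_one, mul_one,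
    Fin.succAbove_last, Fin.val_castSucc, ← hchoose] at hdelete
  have hfactorial : ((p : ℕ).factorial * (n - p : ℕ).factorial : ℤ) ≠ 0 := by positivity
  have hvandermonde : (n.choose p : ℤ) * (vandermonde fun i : Fin n => (i : ℤ)).det =
      (vandermonde fun i : Fin n => (p.succAbove i : ℤ)).det :=
    mul_left_cancel₀ hfactorial (by linear_combination hdelete)
  refine Nat.cast_injective (R := ℤ) (mul_left_cancel₀ (det_vandermonde_val_ne_zero (n := n)) ?_)
  push_cast
  linear_combination henum - 2 ^ n.choose 2 * hvandermonde

theorem monotoneTriangleEnum_two_two_mul_val_add_one :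
    monotoneTriangleEnum (2 : ℕ) n (fun i => 2 * (i : ℕ) + 1) = 2 ^ (n * (n - 1)) := by
  have h := det_vandermonde_val_mul_natCast_monotoneTriangleEnum_two
    (strictMono_two_mul_val_add_one (n := n))
  rw [det_vandermonde_add (fun i : Fin n => 2 * (i : ℤ)) 1, det_vandermonde_const_mul, ← mul_assoc,
    ← pow_add, ← two_mul, Nat.choose_two_right,
    Nat.mul_div_cancel' (Nat.even_mul_pred_self n).two_dvd, mul_comm (2 ^ _)] at h
  exact_mod_cast mul_left_cancel₀ det_vandermonde_val_ne_zero h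

end MonotoneTriangles

section TailSums

open Matrix

variable {n : ℕ} {M : Type*}

/-- The sum of the terms of a finite sequence from position `t` on. Tails rather than initial
segments are used because rows will be added at the top of a matrix. -/
def tailSum [AddCommMonoid M] (v : Fin n → M) (t : ℕ) : M :=
  ∑ i ∈ {i : Fin n | t ≤ i}, v i

section AddCommMonoid

variable [AddCommMonoid M] (v : Fin n → M)

theorem tailSum_zero : tailSum v 0 = ∑ i, v i := by
  simp [tailSum]

theorem tailSum_of_le {t : ℕ} (ht : n ≤ t) : tailSum v t = 0 :=
  Finset.sum_eq_zero fun i hi => absurd (Finset.mem_filter.1 hi).2 (by omega)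

theorem tailSum_val (i : Fin n) : tailSum v i = v i + tailSum v (i + 1) := by
  have hIci : (Finset.univ.filter fun j : Fin n => (i : ℕ) ≤ j) = insert i (Finset.Ioi i) := by
    ext j
    simp only [Finset.mem_filter_univ, Finset.mem_insert, Finset.mem_Ioi]
    omega
  have hIoi : (Finset.univ.filter fun j : Fin n => (i : ℕ) + 1 ≤ j) = Finset.Ioi i := by
    ext j
    simp only [Finset.mem_filter_univ, Finset.mem_Ioi]
    omega
  rw [tailSum, tailSum, hIci, hIoi, Finset.sum_insert (by simp)]

theorem tailSum_vecCons_succ (x : M) (t : ℕ) : tailSum (vecCons x v) (t + 1) = tailSum v t := by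
  simp [tailSum, Finset.sum_filter, Fin.sum_univ_succ]

theorem tailSum_add_tailSum_rev (t : ℕ) :
    tailSum v t + tailSum (fun i => v i.rev) (n - t) = ∑ i, v i := by
  have hrev : tailSum (fun i => v i.rev) (n - t) =
      ∑ i ∈ {i : Fin n | ¬ t ≤ i}, v i := by
    rw [tailSum, Finset.sum_filter, Finset.sum_filter, ← Equiv.sum_comp Fin.revPerm]
    refine Finset.sum_congr rfl fun i _ => ?_
    have hiff : n - t ≤ (i.rev : ℕ) ↔ ¬ t ≤ (i : ℕ) := by rw [Fin.val_rev]; omega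
    simp only [Fin.revPerm_apply, Fin.rev_rev, hiff]
  rw [hrev, tailSum, Finset.sum_filter_add_sum_filter_not]

end AddCommMonoid

theorem tailSum_sub [AddCommGroup M] (v w : Fin n → M) (t : ℕ) :
    tailSum (v - w) t = tailSum v t - tailSum w t :=
  Finset.sum_sub_distrib v w

/-- The tail sums of a sequence all lie in `{0, 1}`. Together with total sum `1` this says that the
sequence has entries `0, 1, -1` alternating in sign, but unlike alternation it can be read off from
partial sums of columns. -/
def HasZeroOneTailSums (v : Fin n → ℤ) : Prop :=
  ∀ t, tailSum v t = 0 ∨ tailSum v t = 1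

variable {v : Fin n → ℤ}

theorem AlternatesInSign.rev (hv : AlternatesInSign v) : AlternatesInSign fun i => v i.rev := by
  intro i j hij hi hj hzero
  have hneg := hv j.rev i.rev (Fin.rev_lt_rev.2 hij) hj hi fun m hjm hmi => by
    simpa using hzero m.rev (Fin.lt_rev_iff.1 hmi) (Fin.rev_lt_iff.1 hjm)
  simp [hneg]

theorem AlternatesInSign.tailSum_eq_zero_or_eq_first_ne_zero (hv : AlternatesInSign v) {t : ℕ}
    (ht : t ≤ n) :
    tailSum v t = 0 ∨ ∃ i : Fin n, t ≤ i ∧ v i ≠ 0 ∧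
      (∀ m : Fin n, t ≤ m → m < i → v m = 0) ∧ tailSum v t = v i := by
  induction ht using Nat.decreasingInduction with
  | self => exact .inl (tailSum_of_le v le_rfl)
  | of_succ t ht ih =>
    have hstep := tailSum_val v ⟨t, ht⟩
    dsimp only at hstep
    by_cases hzero : v ⟨t, ht⟩ = 0
    · rw [hstep, hzero, zero_add]
      refine ih.imp_right fun ⟨i, hti, hi, hfirst, hsum⟩ =>
        ⟨i, by omega, hi, fun m hm hmi => ?_, hsum⟩
      rcases hm.eq_or_lt with rfl | hm
      · exact hzero
      · exact hfirst m hm hmi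
    · rcases ih with hsum | ⟨i, hti, hi, hfirst, hsum⟩
      · refine .inr ⟨⟨t, ht⟩, le_rfl, hzero, fun m hm hmt => ?_, by rw [hstep, hsum, add_zero]⟩
        exact absurd (Fin.lt_def.1 hmt) hm.not_gt
      · left
        rw [hstep, hsum, hv ⟨t, ht⟩ i hti hzero hi fun m hm hmi => hfirst m hm hmi, add_neg_cancel]

theorem AlternatesInSign.tailSum_mem (hv : AlternatesInSign v)
    (hentries : ∀ i, v i = 0 ∨ v i = 1 ∨ v i = -1) (t : ℕ) :
    tailSum v t = 0 ∨ tailSum v t = 1 ∨ tailSum v t = -1 := by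
  rcases le_total n t with ht | ht
  · exact .inl (tailSum_of_le v ht)
  · rcases hv.tailSum_eq_zero_or_eq_first_ne_zero ht with hsum | ⟨i, -, -, -, hsum⟩
    · exact .inl hsum
    · exact hsum ▸ hentries i

/-- A tail sum `-1` would leave an initial sum `2`, which is a tail sum of the reversed sequence. -/
theorem AlternatesInSign.hasZeroOneTailSums (hv : AlternatesInSign v)
    (hentries : ∀ i, v i = 0 ∨ v i = 1 ∨ v i = -1) (hsum : ∑ i, v i = 1) :
    HasZeroOneTailSums v := by
  intro t
  have htail := hv.tailSum_mem hentries t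
  have hinit := hv.rev.tailSum_mem (fun i => hentries i.rev) (n - t)
  have htotal := tailSum_add_tailSum_rev v t
  omega

theorem HasZeroOneTailSums.eq_zero_or_one_or_neg_one (hv : HasZeroOneTailSums v) (i : Fin n) :
    v i = 0 ∨ v i = 1 ∨ v i = -1 := by
  have hstep := tailSum_val v i
  have h₀ := hv i
  have h₁ := hv (i + 1)
  omega

theorem HasZeroOneTailSums.alternatesInSign (hv : HasZeroOneTailSums v) : AlternatesInSign v := by
  intro i j hij hi hj hzero
  have hconst (t : ℕ) (ht : t ≤ j) (hit : i < t) : tailSum v t = tailSum v j := by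
    induction ht using Nat.decreasingInduction with
    | self => rfl
    | of_succ t ht ih =>
      have hstep := tailSum_val v ⟨t, ht.trans j.isLt⟩
      rw [hzero _ hit ht, zero_add] at hstep
      exact hstep.trans (ih (by omega))
  have hbetween := hconst (i + 1) hij (Nat.lt_succ_self i)
  have hstep_i := tailSum_val v i
  have hstep_j := tailSum_val v j
  have h₁ := hv i
  have h₂ := hv j
  have h₃ := hv (j + 1)
  omega

theorem isASM_iff_hasZeroOneTailSums {A : Matrix (Fin n) (Fin n) ℤ} :
    IsASM A ↔ ((∀ i, HasZeroOneTailSums (A i)) ∧ ∀ i, ∑ j, A i j = 1) ∧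
      (∀ j, HasZeroOneTailSums fun i => A i j) ∧ ∀ j, ∑ i, A i j = 1 where
  mp h := ⟨⟨fun i => (h.row_alt i).hasZeroOneTailSums (h.entries i) (h.row_sum i), h.row_sum⟩,
    fun j => (h.col_alt j).hasZeroOneTailSums (fun i => h.entries i j) (h.col_sum j), h.col_sum⟩
  mpr := fun ⟨⟨hrow, hrow_sum⟩, hcol, hcol_sum⟩ =>
    ⟨fun i => (hrow i).eq_zero_or_one_or_neg_one, hrow_sum, hcol_sum,
      fun i => (hrow i).alternatesInSign, fun j => (hcol j).alternatesInSign⟩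

end TailSums

section PartialASM

open Matrix

variable {m N : ℕ}

/-- The number of terms of `k` that are at least `t`. -/
def countGE (k : Fin m → ℤ) (t : ℤ) : ℕ :=
  Finset.card {i : Fin m | t ≤ k i}

theorem countGE_le (k : Fin m → ℤ) (t : ℤ) : countGE k t ≤ m :=
  (Finset.card_le_univ _).trans_eq (Fintype.card_fin m)

theorem le_iff_le_add_countGE {k : Fin m → ℤ} (hk : Monotone k) (i : Fin m) (t : ℤ) :
    t ≤ k i ↔ m ≤ i + countGE k t := by
  constructor
  · intro hi
    have hsub : Finset.Ici i ⊆ Finset.univ.filter fun j => t ≤ k j := fun j hj =>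
      (Finset.mem_filter_univ j).2 (hi.trans (hk (Finset.mem_Ici.1 hj)))
    have hcard := Finset.card_le_card hsub
    rw [Fin.card_Ici] at hcard
    rw [countGE]
    omega
  · contrapose!
    intro hi
    have hsub : (Finset.univ.filter fun j => t ≤ k j) ⊆ Finset.Ioi i := fun j hj =>
      Finset.mem_Ioi.2 (hk.reflect_lt (hi.trans_le ((Finset.mem_filter_univ j).1 hj)))
    have hcard := Finset.card_le_card hsub
    rw [Fin.card_Ioi] at hcard
    rw [countGE]
    omega

theorem countGE_of_mem_interlacing {k : Fin (m + 1) → ℤ} (hk : Monotone k) {l : Fin m → ℤ}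
    (hl : l ∈ interlacing k) (t : ℤ) :
    countGE k t = countGE l t ∨ countGE k t = countGE l t + 1 := by
  have hbounds := (mem_interlacing.1 hl).1
  have hiff_k := le_iff_le_add_countGE hk (t := t)
  have hiff_l := le_iff_le_add_countGE (strictMono_of_mem_interlacing hl).monotone (t := t)
  have hk_le := countGE_le k t
  have hl_le := countGE_le l t
  have hlower : countGE l t ≤ countGE k t := by
    by_contra! hlt
    let i : Fin m := ⟨m - countGE l t, by omega⟩
    have hi := (hiff_k i.succ).1 (((hiff_l i).2 (by grind)).trans (hbounds i).2)
    grind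
  have hupper : countGE k t ≤ countGE l t + 1 := by
    by_contra! hlt
    let i : Fin m := ⟨m - 1 - countGE l t, by omega⟩
    have hi := (hiff_l i).1 (((hiff_k i.castSucc).2 (by grind)).trans (hbounds i).1)
    grind
  omega

theorem mem_interlacing_of_countGE {k : Fin (m + 1) → ℤ} {l : Fin m → ℤ} (hk : Monotone k)
    (hl : StrictMono l) (hk_nonneg : ∀ i, 0 ≤ k i) (hl_nonneg : ∀ i, 0 ≤ l i)
    (h : ∀ t : ℕ, countGE k t = countGE l t ∨ countGE k t = countGE l t + 1) :
    l ∈ interlacing k := by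
  refine mem_interlacing.2 ⟨fun i => ⟨?_, ?_⟩, hl⟩
  · have hcount := h (k i.castSucc).toNat
    rw [Int.toNat_of_nonneg (hk_nonneg _)] at hcount
    have hself := (le_iff_le_add_countGE hk i.castSucc _).1 le_rfl
    rw [Fin.val_castSucc] at hself
    exact (le_iff_le_add_countGE hl.monotone i _).2 (by omega)
  · have hcount := h (l i).toNat
    rw [Int.toNat_of_nonneg (hl_nonneg _)] at hcount
    have hself := (le_iff_le_add_countGE hl.monotone i _).1 le_rfl
    refine (le_iff_le_add_countGE hk i.succ _).2 ?_
    rw [Fin.val_succ]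
    omega

theorem mem_Ico_of_mem_interlacing {k : Fin (m + 1) → ℤ} {l : Fin m → ℤ} {a b : ℤ}
    (hk : ∀ i, k i ∈ Set.Ico a b) (hl : l ∈ interlacing k) (i : Fin m) : l i ∈ Set.Ico a b :=
  ⟨(hk i.castSucc).1.trans ((mem_interlacing.1 hl).1 i).1,
    ((mem_interlacing.1 hl).1 i).2.trans_lt (hk i.succ).2⟩

theorem notMem_range_iff_of_mem_interlacing {k : Fin (m + 1) → ℤ} {l : Fin m → ℤ}
    (hk : StrictMono k) (hl : l ∈ interlacing k) (i : Fin m) :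
    l i ∉ Set.range k ↔ k i.castSucc < l i ∧ l i < k i.succ := by
  have hbounds := (mem_interlacing.1 hl).1 i
  constructor
  · intro hi
    exact ⟨hbounds.1.lt_of_ne fun h => hi ⟨_, h⟩, hbounds.2.lt_of_ne fun h => hi ⟨_, h.symm⟩⟩
  · rintro ⟨hlt, hgt⟩ ⟨j, hj⟩
    have h₁ := hk.lt_iff_lt.1 (hlt.trans_eq hj.symm)
    have h₂ := hk.lt_iff_lt.1 (hj.trans_lt hgt)
    rw [Fin.lt_def] at h₁ h₂
    simp only [Fin.val_castSucc, Fin.val_succ] at h₁ h₂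
    omega

/-- The indicator vector of length `N` of the set of terms of `k`, positions being numbered from
`0`. -/
noncomputable def rangeIndicator (N : ℕ) (k : Fin m → ℤ) : Fin N → ℤ :=
  fun c => (Set.range k).indicator 1 (c : ℤ)

theorem rangeIndicator_eq_zero_or_one (k : Fin m → ℤ) (c : Fin N) :
    rangeIndicator N k c = 0 ∨ rangeIndicator N k c = 1 :=
  Set.indicator_eq_zero_or_self _ _ _

theorem rangeIndicator_eq_one_iff {k : Fin m → ℤ} {c : Fin N} :
    rangeIndicator N k c = 1 ↔ (c : ℤ) ∈ Set.range k :=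
  Set.indicator_eq_one_iff_mem ℤ

theorem rangeIndicator_eq_zero_iff {k : Fin m → ℤ} {c : Fin N} :
    rangeIndicator N k c = 0 ↔ (c : ℤ) ∉ Set.range k :=
  Set.indicator_eq_zero_iff_notMem ℤ

theorem card_filter_mem_range_and {k : Fin m → ℤ} (hk : Function.Injective k)
    (hkN : ∀ i, k i ∈ Set.Ico 0 (N : ℤ)) (P : ℤ → Prop) [DecidablePred P]
    [DecidablePred (· ∈ Set.range k)] :
    Finset.card {c : Fin N | (c : ℤ) ∈ Set.range k ∧ P c} = Finset.card {i | P (k i)} := by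
  obtain ⟨c, rfl⟩ : ∃ c : Fin m → Fin N, (fun i => ((c i : ℕ) : ℤ)) = k :=
    ⟨fun i => ⟨(k i).toNat, by have := hkN i; grind⟩, funext fun i => Int.toNat_of_nonneg (hkN i).1⟩
  have hc : Function.Injective c := fun i j h => hk (by simp only [h])
  rw [← Finset.card_map ⟨c, hc⟩]
  congr 1
  ext d
  simp only [Finset.mem_filter_univ, Finset.mem_map, Function.Embedding.coeFn_mk, Set.mem_range,
    Nat.cast_inj, Fin.val_inj]
  constructor
  · rintro ⟨⟨i, rfl⟩, hP⟩
    exact ⟨i, hP, rfl⟩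
  · rintro ⟨i, hP, rfl⟩
    exact ⟨⟨i, rfl⟩, hP⟩

theorem exists_strictMono_rangeIndicator_eq {v : Fin N → ℤ} (hv : ∀ c, v c = 0 ∨ v c = 1)
    (hsum : ∑ c, v c = m) :
    ∃ k : Fin m → ℤ, StrictMono k ∧ (∀ i, k i ∈ Set.Ico 0 (N : ℤ)) ∧ rangeIndicator N k = v := by
  have hcard : Finset.card {c | v c = 1} = m := by
    rw [← Nat.cast_inj (R := ℤ), ← hsum, Finset.natCast_card_filter]
    exact Finset.sum_congr rfl fun c _ => by grind
  let e := Finset.orderEmbOfFin {c | v c = 1} hcard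
  refine ⟨fun i => (e i : ℕ), strictMono_val.comp e.strictMono,
    fun i => ⟨Int.natCast_nonneg _, Int.ofNat_lt.2 (e i).isLt⟩, funext fun c => ?_⟩
  have hmem : (c : ℤ) ∈ Set.range (fun i => ((e i : ℕ) : ℤ)) ↔ v c = 1 := by
    have hrange := Set.ext_iff.1 (Finset.range_orderEmbOfFin _ hcard) c
    simpa only [Set.mem_range, Nat.cast_inj, Fin.val_inj, Finset.mem_coe, Finset.mem_filter_univ]
      using hrange
  rcases hv c with h | h
  · rw [h, rangeIndicator_eq_zero_iff, hmem, h]; exact zero_ne_one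
  · rwa [h, rangeIndicator_eq_one_iff, hmem]

theorem rangeIndicator_injOn :
    Set.InjOn (rangeIndicator (m := m) N) {k | StrictMono k ∧ ∀ i, k i ∈ Set.Ico 0 (N : ℤ)} := by
  have hsub {k l : Fin m → ℤ} (hkN : ∀ i, k i ∈ Set.Ico 0 (N : ℤ))
      (h : rangeIndicator N k = rangeIndicator N l) : Set.range k ⊆ Set.range l := by
    rintro _ ⟨i, rfl⟩
    lift k i to ℕ using (hkN i).1 with c hc
    have hcN : c < N := by have := (hkN i).2; omega
    exact rangeIndicator_eq_one_iff.1
      ((congrFun h ⟨c, hcN⟩).symm.trans (rangeIndicator_eq_one_iff.2 ⟨i, hc.symm⟩))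
  exact fun k hk l hl h =>
    (StrictMono.range_inj hk.1 hl.1).1 ((hsub hk.2 h).antisymm (hsub hl.2 h.symm))

theorem tailSum_rangeIndicator {k : Fin m → ℤ} (hk : Function.Injective k)
    (hkN : ∀ i, k i ∈ Set.Ico 0 (N : ℤ)) (t : ℕ) :
    tailSum (rangeIndicator N k) t = countGE k t := by
  classical
  rw [countGE, ← card_filter_mem_range_and hk hkN, Finset.natCast_card_filter, tailSum,
    Finset.sum_filter]
  refine Finset.sum_congr rfl fun c _ => ?_
  simp only [rangeIndicator, Set.indicator_apply, Pi.one_apply, Nat.cast_le]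
  grind

theorem sum_rangeIndicator {k : Fin m → ℤ} (hk : Function.Injective k)
    (hkN : ∀ i, k i ∈ Set.Ico 0 (N : ℤ)) : ∑ c, rangeIndicator N k c = m := by
  rw [← tailSum_zero, tailSum_rangeIndicator hk hkN, countGE, Nat.cast_zero,
    Finset.filter_true_of_mem fun i _ => (hkN i).1, Finset.card_univ, Fintype.card_fin]

theorem hasZeroOneTailSums_rangeIndicator_sub_iff {k : Fin (m + 1) → ℤ} (hk : StrictMono k)
    (hkN : ∀ i, k i ∈ Set.Ico 0 (N : ℤ)) {l : Fin m → ℤ} (hl : StrictMono l)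
    (hlN : ∀ i, l i ∈ Set.Ico 0 (N : ℤ)) :
    HasZeroOneTailSums (rangeIndicator N k - rangeIndicator N l) ↔ l ∈ interlacing k := by
  simp only [HasZeroOneTailSums, tailSum_sub, tailSum_rangeIndicator hk.injective hkN,
    tailSum_rangeIndicator hl.injective hlN]
  constructor
  · intro h
    refine mem_interlacing_of_countGE hk.monotone hl (fun i => (hkN i).1) (fun i => (hlN i).1)
      fun t => ?_
    have ht := h t
    omega
  · intro h t
    have ht := countGE_of_mem_interlacing hk.monotone h t
    omega

theorem card_rangeIndicator_sub_eq_neg_one {k : Fin (m + 1) → ℤ} (hk : StrictMono k)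
    (hkN : ∀ i, k i ∈ Set.Ico 0 (N : ℤ)) {l : Fin m → ℤ} (hl : l ∈ interlacing k) :
    Finset.card {c | (rangeIndicator N k - rangeIndicator N l) c = -1} = strictCount k l := by
  classical
  have hiff (c : Fin N) : (rangeIndicator N k - rangeIndicator N l) c = -1 ↔
      (c : ℤ) ∈ Set.range l ∧ (c : ℤ) ∉ Set.range k := by
    rw [← rangeIndicator_eq_one_iff, ← rangeIndicator_eq_zero_iff, Pi.sub_apply]
    have hk01 := rangeIndicator_eq_zero_or_one k c
    have hl01 := rangeIndicator_eq_zero_or_one l c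
    omega
  simp only [hiff, strictCount, ← notMem_range_iff_of_mem_interlacing hk hl]
  exact card_filter_mem_range_and (strictMono_of_mem_interlacing hl).injective
    (mem_Ico_of_mem_interlacing hkN hl) (· ∉ Set.range k)

/-- The bottom `m` rows of an alternating sign matrix with `N` columns, where `k` lists the columns
with sum `1`; the other columns have sum `0`. The sequences `k` obtained by deleting one row after
the other from the top of an alternating sign matrix form its monotone triangle. -/
structure IsPartialASM (k : Fin m → ℤ) (A : Matrix (Fin m) (Fin N) ℤ) : Prop where
  row_tailSums : ∀ i, HasZeroOneTailSums (A i)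
  row_sum : ∀ i, ∑ j, A i j = 1
  col_tailSums : ∀ j, HasZeroOneTailSums fun i => A i j
  col_sum : ∀ j, ∑ i, A i j = rangeIndicator N k j

/-- The number of entries `-1` of a rectangular matrix. -/
def negEntryCount (A : Matrix (Fin m) (Fin N) ℤ) : ℕ :=
  Finset.card {p : Fin m × Fin N | A p.1 p.2 = -1}

/-- The matrix with first row `r` whose other rows form the matrix `B`. -/
def addTopRow (r : Fin N → ℤ) (B : Matrix (Fin m) (Fin N) ℤ) : Matrix (Fin (m + 1)) (Fin N) ℤ :=
  of (vecCons r (of.symm B))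

theorem addTopRow_submatrix_succ (A : Matrix (Fin (m + 1)) (Fin N) ℤ) :
    addTopRow (A 0) (A.submatrix Fin.succ id) = A :=
  funext (Fin.cases rfl fun _ => rfl)

theorem addTopRow_col (r : Fin N → ℤ) (B : Matrix (Fin m) (Fin N) ℤ) (j : Fin N) :
    (fun i => addTopRow r B i j) = vecCons (r j) fun i => B i j :=
  funext (Fin.cases rfl fun _ => rfl)

theorem negEntryCount_addTopRow (r : Fin N → ℤ) (B : Matrix (Fin m) (Fin N) ℤ) :
    negEntryCount (addTopRow r B) = Finset.card {c | r c = -1} + negEntryCount B := by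
  simp only [negEntryCount, Finset.card_filter, Fintype.sum_prod_type, Fin.sum_univ_succ]
  rfl

theorem hasZeroOneTailSums_vecCons_iff {x : ℤ} {v : Fin m → ℤ} :
    HasZeroOneTailSums (vecCons x v) ↔
      (x + ∑ i, v i = 0 ∨ x + ∑ i, v i = 1) ∧ HasZeroOneTailSums v := by
  have hzero : tailSum (vecCons x v) 0 = x + ∑ i, v i := by
    rw [tailSum_zero, Fin.sum_univ_succ]
    rfl
  constructor
  · exact fun h => ⟨hzero ▸ h 0, fun t => tailSum_vecCons_succ v x t ▸ h (t + 1)⟩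
  · rintro ⟨hsum, hv⟩ (_ | t)
    · rwa [hzero]
    · rw [tailSum_vecCons_succ]
      exact hv t

theorem isPartialASM_addTopRow_iff {k : Fin (m + 1) → ℤ} (hk : StrictMono k)
    (hkN : ∀ i, k i ∈ Set.Ico 0 (N : ℤ)) {r : Fin N → ℤ} {B : Matrix (Fin m) (Fin N) ℤ} :
    IsPartialASM k (addTopRow r B) ↔
      ∃ l ∈ interlacing k, r = rangeIndicator N k - rangeIndicator N l ∧ IsPartialASM l B := by
  have hcol_sum (j : Fin N) : ∑ i, addTopRow r B i j = r j + ∑ i, B i j := Fin.sum_univ_succ _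
  constructor
  · rintro ⟨hrow, hrow_sum, hcol_tail, hsum⟩
    simp only [addTopRow_col, hasZeroOneTailSums_vecCons_iff] at hcol_tail
    simp only [hcol_sum] at hsum
    have htotal : ∑ j, ∑ i, B i j = m := by
      rw [Finset.sum_comm, Finset.sum_congr rfl fun i _ => hrow_sum i.succ]
      simp
    have h01 (j : Fin N) : ∑ i, B i j = 0 ∨ ∑ i, B i j = 1 :=
      tailSum_zero (fun i => B i j) ▸ (hcol_tail j).2 0
    obtain ⟨l, hl, hlN, hlB⟩ := exists_strictMono_rangeIndicator_eq h01 htotal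
    have hr : r = rangeIndicator N k - rangeIndicator N l :=
      funext fun j => by rw [Pi.sub_apply, ← hsum j, hlB, add_sub_cancel_right]
    refine ⟨l, ?_, hr, fun i => hrow i.succ, fun i => hrow_sum i.succ,
      fun j => (hcol_tail j).2, fun j => (congrFun hlB j).symm⟩
    exact (hasZeroOneTailSums_rangeIndicator_sub_iff hk hkN hl hlN).1 (hr ▸ hrow 0)
  · rintro ⟨l, hl, rfl, hB⟩
    have hl_mono := strictMono_of_mem_interlacing hl
    have hlN := mem_Ico_of_mem_interlacing hkN hl
    have hr_sum : ∑ j, (rangeIndicator N k - rangeIndicator N l) j = 1 := by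
      simp [sum_rangeIndicator hk.injective hkN, sum_rangeIndicator hl_mono.injective hlN]
    have hr_tail := (hasZeroOneTailSums_rangeIndicator_sub_iff hk hkN hl_mono hlN).2 hl
    refine ⟨Fin.cases hr_tail hB.row_tailSums, Fin.cases hr_sum hB.row_sum,
      fun j => ?_, fun j => ?_⟩
    · rw [addTopRow_col, hasZeroOneTailSums_vecCons_iff, hB.col_sum, Pi.sub_apply, sub_add_cancel]
      exact ⟨rangeIndicator_eq_zero_or_one k j, hB.col_tailSums j⟩
    · rw [hcol_sum, hB.col_sum, Pi.sub_apply, sub_add_cancel]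

theorem setOf_isPartialASM_succ {k : Fin (m + 1) → ℤ} (hk : StrictMono k)
    (hkN : ∀ i, k i ∈ Set.Ico 0 (N : ℤ)) :
    {A : Matrix (Fin (m + 1)) (Fin N) ℤ | IsPartialASM k A} =
      ⋃ l ∈ interlacing k, addTopRow (rangeIndicator N k - rangeIndicator N l) ''
        {B : Matrix (Fin m) (Fin N) ℤ | IsPartialASM l B} := by
  ext A
  simp only [Set.mem_iUnion, Set.mem_image]
  constructor
  · intro hA
    rw [← addTopRow_submatrix_succ A] at hA
    obtain ⟨l, hl, hr, hB⟩ := (isPartialASM_addTopRow_iff hk hkN).1 hA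
    exact ⟨l, hl, _, hB, hr ▸ addTopRow_submatrix_succ A⟩
  · rintro ⟨l, hl, B, hB, rfl⟩
    exact (isPartialASM_addTopRow_iff hk hkN).2 ⟨l, hl, rfl, hB⟩

theorem setOf_isPartialASM_zero (k : Fin 0 → ℤ) :
    {A : Matrix (Fin 0) (Fin N) ℤ | IsPartialASM k A} = {0} := by
  refine Set.eq_singleton_iff_unique_mem.2
    ⟨⟨fun i => i.elim0, fun i => i.elim0, fun j t => ?_, fun j => ?_⟩,
      fun A _ => Subsingleton.elim A 0⟩
  · exact .inl (tailSum_of_le _ t.zero_le)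
  · simp [rangeIndicator]

theorem finite_setOf_isPartialASM {k : Fin m → ℤ} (hk : StrictMono k)
    (hkN : ∀ i, k i ∈ Set.Ico 0 (N : ℤ)) :
    {A : Matrix (Fin m) (Fin N) ℤ | IsPartialASM k A}.Finite := by
  induction m with
  | zero => exact Set.toFinite _
  | succ m ih =>
    rw [setOf_isPartialASM_succ hk hkN]
    exact (interlacing k).finite_toSet.biUnion fun l hl =>
      (ih (strictMono_of_mem_interlacing hl) (mem_Ico_of_mem_interlacing hkN hl)).image _

theorem pairwiseDisjoint_setOf_isPartialASM :
    {k : Fin m → ℤ | StrictMono k ∧ ∀ i, k i ∈ Set.Ico 0 (N : ℤ)}.PairwiseDisjoint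
      fun k => {A : Matrix (Fin m) (Fin N) ℤ | IsPartialASM k A} :=
  fun _ hk _ hl hne => Set.disjoint_left.2 fun _ hA hA' => hne <| rangeIndicator_injOn hk hl <|
    funext fun j => (hA.col_sum j).symm.trans (hA'.col_sum j)

theorem finsum_isPartialASM_pow_negEntryCount {R : Type*} [CommSemiring R] (Q : R)
    {k : Fin m → ℤ} (hk : StrictMono k) (hkN : ∀ i, k i ∈ Set.Ico 0 (N : ℤ)) :
    ∑ᶠ A ∈ {A : Matrix (Fin m) (Fin N) ℤ | IsPartialASM k A}, Q ^ negEntryCount A =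
      monotoneTriangleEnum Q m k := by
  induction m with
  | zero => simp [setOf_isPartialASM_zero, monotoneTriangleEnum_zero, negEntryCount]
  | succ m ih =>
    have hmono {l : Fin m → ℤ} (hl : l ∈ interlacing k) := strictMono_of_mem_interlacing hl
    have hrange {l : Fin m → ℤ} (hl : l ∈ interlacing k) := mem_Ico_of_mem_interlacing hkN hl
    rw [setOf_isPartialASM_succ hk hkN, monotoneTriangleEnum_succ Q hk,
      finsum_mem_biUnion_image_of_leftInverse (δ := fun A => A.submatrix Fin.succ id)
        (fun l hl => finite_setOf_isPartialASM (hmono hl) (hrange hl))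
        (pairwiseDisjoint_setOf_isPartialASM.subset fun l hl => ⟨hmono hl, hrange hl⟩)
        fun _ _ _ _ => rfl]
    refine Finset.sum_congr rfl fun l hl => ?_
    rw [← ih (hmono hl) (hrange hl), mul_finsum_mem' _ _
      (finite_setOf_isPartialASM (hmono hl) (hrange hl))]
    exact finsum_mem_congr rfl fun B _ => by
      rw [negEntryCount_addTopRow, card_rangeIndicator_sub_eq_neg_one hk hkN hl, pow_add]

end PartialASM

section ASM

open Matrix

variable {m n : ℕ} {R : Type*} [CommSemiring R]

theorem val_mem_Ico (i : Fin n) : ((i : ℕ) : ℤ) ∈ Set.Ico 0 (n : ℤ) :=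
  ⟨Int.natCast_nonneg _, Int.ofNat_lt.2 i.isLt⟩

theorem rangeIndicator_val : rangeIndicator n (fun i : Fin n => ((i : ℕ) : ℤ)) = 1 :=
  funext fun c => rangeIndicator_eq_one_iff.2 ⟨c, rfl⟩

theorem isASM_iff_isPartialASM {A : Matrix (Fin n) (Fin n) ℤ} :
    IsASM A ↔ IsPartialASM (fun i => ((i : ℕ) : ℤ)) A := by
  have hcol (j : Fin n) := congrFun (rangeIndicator_val (n := n)) j
  rw [isASM_iff_hasZeroOneTailSums]
  exact ⟨fun ⟨⟨hrow, hrow_sum⟩, hcol_tail, hcol_sum⟩ =>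
      ⟨hrow, hrow_sum, hcol_tail, fun j => (hcol_sum j).trans (hcol j).symm⟩,
    fun h => ⟨⟨h.row_tailSums, h.row_sum⟩, h.col_tailSums, fun j => (h.col_sum j).trans (hcol j)⟩⟩

theorem finite_setOf_isASM : {A : Matrix (Fin n) (Fin n) ℤ | IsASM A}.Finite := by
  simp only [isASM_iff_isPartialASM]
  exact finite_setOf_isPartialASM strictMono_val val_mem_Ico

theorem negOneEnum_setOf_isASM (Q : R) :
    negOneEnum Q {A : Matrix (Fin n) (Fin n) ℤ | IsASM A} =
      monotoneTriangleEnum Q n fun i => (i : ℕ) := by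
  simp only [isASM_iff_isPartialASM]
  exact finsum_isPartialASM_pow_negEntryCount Q strictMono_val val_mem_Ico

theorem val_succAbove_mem_interlacing (p : Fin (m + 1)) :
    (fun i : Fin m => ((p.succAbove i : ℕ) : ℤ)) ∈
      interlacing fun i : Fin (m + 1) => ((i : ℕ) : ℤ) := by
  refine mem_interlacing.2 ⟨fun i => ?_, strictMono_val_succAbove p⟩
  dsimp only [Fin.succAbove]
  split_ifs <;> simp

theorem rangeIndicator_val_succAbove (p : Fin (m + 1)) :
    rangeIndicator (m + 1) (fun i : Fin m => ((p.succAbove i : ℕ) : ℤ)) = 1 - Pi.single p 1 := by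
  have hmem (c : Fin (m + 1)) :
      (c : ℤ) ∈ Set.range (fun i : Fin m => ((p.succAbove i : ℕ) : ℤ)) ↔ c ≠ p := by
    simp only [Set.mem_range, Nat.cast_inj, Fin.val_inj, Fin.exists_succAbove_eq_iff]
  funext c
  by_cases hc : c = p
  · rw [rangeIndicator_eq_zero_iff.2 ((hmem c).not.2 (not_not.2 hc)), hc]
    simp
  · rw [rangeIndicator_eq_one_iff.2 ((hmem c).2 hc)]
    simp [hc]

theorem eq_val_succAbove_of_rangeIndicator_eq_zero {l : Fin m → ℤ} (hl : StrictMono l)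
    (hlN : ∀ i, l i ∈ Set.Ico 0 ((m + 1 : ℕ) : ℤ)) {p : Fin (m + 1)}
    (hp : rangeIndicator (m + 1) l p = 0) : l = fun i => ((p.succAbove i : ℕ) : ℤ) := by
  refine rangeIndicator_injOn ⟨hl, hlN⟩ ⟨strictMono_val_succAbove p, fun i => val_mem_Ico _⟩ ?_
  have h01 := rangeIndicator_eq_zero_or_one (N := m + 1) l
  have hsum := sum_rangeIndicator hl.injective hlN
  rw [Fin.sum_univ_succAbove _ p, hp, zero_add] at hsum
  have hcompl : ∑ i, (1 - rangeIndicator (m + 1) l (p.succAbove i)) = 0 := by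
    rw [Finset.sum_sub_distrib, hsum]
    simp
  rw [Finset.sum_eq_zero_iff_of_nonneg fun i _ => by grind] at hcompl
  rw [rangeIndicator_val_succAbove]
  funext c
  rcases Fin.eq_self_or_eq_succAbove p c with rfl | ⟨i, rfl⟩
  · simp [hp]
  · have := hcompl i (Finset.mem_univ i)
    rw [Pi.sub_apply, Pi.one_apply, Pi.single_eq_of_ne (Fin.succAbove_ne p i)]
    omega

theorem setOf_isASM_and_eq_one (p : Fin (m + 1)) :
    {A : Matrix (Fin (m + 1)) (Fin (m + 1)) ℤ | IsASM A ∧ A 0 p = 1} =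
      addTopRow (Pi.single p 1) '' {B : Matrix (Fin m) (Fin (m + 1)) ℤ |
        IsPartialASM (fun i => ((p.succAbove i : ℕ) : ℤ)) B} := by
  have htop : Pi.single p 1 = rangeIndicator (m + 1) (fun i : Fin (m + 1) => ((i : ℕ) : ℤ)) -
      rangeIndicator (m + 1) (fun i : Fin m => ((p.succAbove i : ℕ) : ℤ)) := by
    rw [rangeIndicator_val, rangeIndicator_val_succAbove, sub_sub_cancel]
  ext A
  constructor
  · rintro ⟨hA, hp⟩
    rw [isASM_iff_isPartialASM, ← addTopRow_submatrix_succ A] at hA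
    obtain ⟨l, hl, hr, hB⟩ := (isPartialASM_addTopRow_iff strictMono_val val_mem_Ico).1 hA
    obtain rfl := eq_val_succAbove_of_rangeIndicator_eq_zero (strictMono_of_mem_interlacing hl)
      (mem_Ico_of_mem_interlacing val_mem_Ico hl) (p := p) (by
        rw [hr, rangeIndicator_val, Pi.sub_apply, Pi.one_apply] at hp
        omega)
    exact ⟨_, hB, by rw [htop, ← hr, addTopRow_submatrix_succ]⟩
  · rintro ⟨B, hB, rfl⟩
    refine ⟨isASM_iff_isPartialASM.2 ?_, Pi.single_eq_same p 1⟩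
    exact (isPartialASM_addTopRow_iff strictMono_val val_mem_Ico).2
      ⟨_, val_succAbove_mem_interlacing p, htop, hB⟩

theorem negOneEnum_setOf_isASM_and_eq_one (Q : R) (p : Fin (m + 1)) :
    negOneEnum Q {A : Matrix (Fin (m + 1)) (Fin (m + 1)) ℤ | IsASM A ∧ A 0 p = 1} =
      monotoneTriangleEnum Q m fun i => (p.succAbove i : ℕ) := by
  have hcount (B : Matrix (Fin m) (Fin (m + 1)) ℤ) :
      negOneCount (addTopRow (Pi.single p 1) B) = negEntryCount B := by
    refine (negEntryCount_addTopRow _ B).trans ?_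
    rw [Finset.filter_false_of_mem fun c _ => ?_, Finset.card_empty, zero_add]
    rw [Pi.single_apply]
    split_ifs <;> decide
  rw [negOneEnum, setOf_isASM_and_eq_one, finsum_mem_image (Function.LeftInverse.injective
    (g := fun A => A.submatrix Fin.succ id) fun _ => rfl).injOn]
  simp only [hcount]
  exact finsum_isPartialASM_pow_negEntryCount Q (strictMono_val_succAbove p) fun i => val_mem_Ico _

end ASM

section VSASM

open Matrix

theorem tailSum_of_eq_comp_add {M : Type*} [AddCommMonoid M] {a b n : ℕ} (hn : n = a + b)
    {v : Fin n → M} {w : Fin b → M} (hw : ∀ i : Fin b, w i = v ⟨a + i, by omega⟩) (t : ℕ) :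
    tailSum w t = tailSum v (a + t) := by
  subst hn
  have hleft (i : Fin a) : ¬ a + t ≤ i := by omega
  simp [tailSum, Finset.sum_filter, Fin.sum_univ_add, hw, hleft, Fin.natAdd]

theorem tailSum_add_tailSum_of_rev {M : Type*} [AddCommMonoid M] {n : ℕ} {v : Fin n → M}
    (hv : ∀ i, v i.rev = v i) (t : ℕ) :
    tailSum v t + tailSum v (n - t) = ∑ i, v i := by
  rw [← tailSum_add_tailSum_rev v t, funext hv]

theorem HasZeroOneTailSums.tailSum_eq_of_forall_ne_zero {n : ℕ} {v : Fin n → ℤ}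
    (hv : HasZeroOneTailSums v) (hne : ∀ i, v i ≠ 0) (hsum : ∑ i, v i = 1) {t : ℕ} (ht : t ≤ n) :
    tailSum v t = (t + 1) % 2 := by
  induction t with
  | zero => simpa [tailSum_zero] using hsum
  | succ t ih =>
    have hstep := tailSum_val v ⟨t, ht⟩
    have hne_t := hne ⟨t, ht⟩
    have h₀ := hv t
    have h₁ := hv (t + 1)
    have ih := ih (Nat.le_of_succ_le ht)
    dsimp only at hstep
    push_cast
    omega

theorem tailSum_one_sub_two_mul_mod_two (m : ℕ) {t : ℕ} (ht : t ≤ 2 * m + 1) :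
    tailSum (fun c : Fin (2 * m + 1) => (1 - 2 * ((c : ℕ) % 2 : ℤ))) t = (t + 1) % 2 := by
  induction ht using Nat.decreasingInduction with
  | self => rw [tailSum_of_le _ le_rfl]; push_cast; omega
  | of_succ t ht ih =>
    refine (tailSum_val _ (⟨t, ht⟩ : Fin (2 * m + 1))).trans ?_
    rw [ih]
    push_cast
    omega

variable {m : ℕ}

theorem two_mul_val_add_one_mem_Ico (i : Fin m) :
    (2 * (i : ℕ) + 1 : ℤ) ∈ Set.Ico 0 ((2 * m + 1 : ℕ) : ℤ) := by
  rw [Set.mem_Ico]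
  omega

theorem rangeIndicator_two_mul_val_add_one (c : Fin (2 * m + 1)) :
    rangeIndicator (2 * m + 1) (fun i : Fin m => (2 * (i : ℕ) + 1 : ℤ)) c = (c : ℕ) % 2 := by
  have hmem : (c : ℤ) ∈ Set.range (fun i : Fin m => (2 * (i : ℕ) + 1 : ℤ)) ↔ (c : ℕ) % 2 = 1 := by
    constructor
    · rintro ⟨i, hi⟩
      dsimp only at hi
      omega
    · exact fun hc => ⟨⟨c / 2, by omega⟩, by dsimp only; omega⟩
  by_cases hc : (c : ℕ) % 2 = 1
  · rw [rangeIndicator_eq_one_iff.2 (hmem.2 hc)]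
    omega
  · rw [rangeIndicator_eq_zero_iff.2 (hmem.not.2 hc)]
    omega

/-- The columns to the right of the middle column, written as rows. -/
def rightColumns (A : Matrix (Fin (2 * m + 1)) (Fin (2 * m + 1)) ℤ) :
    Matrix (Fin m) (Fin (2 * m + 1)) ℤ :=
  of fun i c => A c ⟨m + 1 + i, by omega⟩

/-- The vertically symmetric matrix with right half `B`, the middle column being chosen so that all
row sums are `1`. -/
def symmetrize (B : Matrix (Fin m) (Fin (2 * m + 1)) ℤ) :
    Matrix (Fin (2 * m + 1)) (Fin (2 * m + 1)) ℤ :=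
  of fun c j =>
    if hright : m < j then B ⟨j - (m + 1), by omega⟩ c
    else if hleft : j < m then B ⟨m - 1 - j, by omega⟩ c
    else 1 - 2 * ∑ i, B i c

variable {A : Matrix (Fin (2 * m + 1)) (Fin (2 * m + 1)) ℤ} {B : Matrix (Fin m) (Fin (2 * m + 1)) ℤ}

theorem symmetrize_rev (c j : Fin (2 * m + 1)) : symmetrize B c j.rev = symmetrize B c j := by
  simp only [symmetrize, of_apply, Fin.val_rev]
  split_ifs <;> first | rfl | omega | (congr 2; omega)

theorem rightColumns_symmetrize : rightColumns (symmetrize B) = B := by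
  ext i c
  simp [rightColumns, symmetrize, show m < m + 1 + i by omega]

theorem tailSum_rightColumns (c : Fin (2 * m + 1)) (t : ℕ) :
    tailSum (fun i => rightColumns A i c) t = tailSum (A c) (m + 1 + t) :=
  tailSum_of_eq_comp_add (by omega) (fun _ => rfl) t

theorem sum_rightColumns (c : Fin (2 * m + 1)) :
    ∑ i, rightColumns A i c = tailSum (A c) (m + 1) := by
  rw [← tailSum_zero, tailSum_rightColumns, add_zero]

theorem sum_row_eq (hA : ∀ i j, A i j.rev = A i j) (c : Fin (2 * m + 1)) :
    ∑ j, A c j = A c ⟨m, by omega⟩ + 2 * ∑ i, rightColumns A i c := by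
  have hmiddle := tailSum_val (A c) ⟨m, by omega⟩
  have htotal := tailSum_add_tailSum_of_rev (hA c) m
  rw [show 2 * m + 1 - m = m + 1 by omega] at htotal
  rw [sum_rightColumns]
  linear_combination hmiddle - htotal

theorem eq_symmetrize_rightColumns (hA : ∀ i j, A i j.rev = A i j) (hsum : ∀ i, ∑ j, A i j = 1) :
    A = symmetrize (rightColumns A) := by
  ext c j
  simp only [symmetrize, of_apply]
  split_ifs with hright hleft
  · exact congrArg (A c) (Fin.ext (by dsimp only; omega))
  · rw [← hA]
    exact congrArg (A c) (Fin.ext (by simp only [Fin.val_rev]; omega))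
  · have hj : j = ⟨m, by omega⟩ := Fin.ext (by dsimp only; omega)
    rw [hj]
    linear_combination hsum c - sum_row_eq hA c

theorem IsVSASM.isPartialASM_rightColumns (hA : IsVSASM A) :
    IsPartialASM (fun i => (2 * (i : ℕ) + 1 : ℤ)) (rightColumns A) := by
  obtain ⟨⟨hrow, hrow_sum⟩, hcol, hcol_sum⟩ := isASM_iff_hasZeroOneTailSums.1 hA.isASM
  have htail (c : Fin (2 * m + 1)) : HasZeroOneTailSums fun i => rightColumns A i c := fun t =>
    tailSum_rightColumns (A := A) c t ▸ hrow c (m + 1 + t)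
  refine ⟨fun i => hcol _, fun i => hcol_sum _, htail, fun c => ?_⟩
  let middle : Fin (2 * m + 1) := ⟨m, by omega⟩
  have hmiddle (c : Fin (2 * m + 1)) : A c middle = 1 - 2 * ∑ i, rightColumns A i c := by
    linear_combination hrow_sum c - sum_row_eq hA.symm c
  have hne (c : Fin (2 * m + 1)) : A c middle ≠ 0 := by rw [hmiddle]; omega
  have htail_middle {t : ℕ} (ht : t ≤ 2 * m + 1) :=
    (hcol middle).tailSum_eq_of_forall_ne_zero hne (hcol_sum middle) ht
  have hstep := tailSum_val (fun c => A c middle) c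
  rw [htail_middle c.isLt.le, htail_middle (Nat.succ_le_of_lt c.isLt), hmiddle] at hstep
  rw [rangeIndicator_two_mul_val_add_one]
  push_cast at hstep
  omega

theorem sum_symmetrize_row (c : Fin (2 * m + 1)) : ∑ j, symmetrize B c j = 1 := by
  rw [sum_row_eq symmetrize_rev, rightColumns_symmetrize]
  simp [symmetrize]

theorem IsPartialASM.hasZeroOneTailSums_symmetrize_row
    (hB : IsPartialASM (fun i => (2 * (i : ℕ) + 1 : ℤ)) B) (c : Fin (2 * m + 1)) :
    HasZeroOneTailSums (symmetrize B c) := by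
  have hright {t : ℕ} (ht : m + 1 ≤ t) :
      tailSum (symmetrize B c) t = 0 ∨ tailSum (symmetrize B c) t = 1 := by
    obtain ⟨s, rfl⟩ := Nat.exists_eq_add_of_le ht
    rw [← tailSum_rightColumns, rightColumns_symmetrize]
    exact hB.col_tailSums c s
  intro t
  rcases le_or_gt (m + 1) t with ht | ht
  · exact hright ht
  · have hreflect := tailSum_add_tailSum_of_rev (symmetrize_rev (B := B) c) t
    rw [sum_symmetrize_row] at hreflect
    have := hright (t := 2 * m + 1 - t) (by omega)
    omega

theorem IsPartialASM.symmetrize_col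
    (hB : IsPartialASM (fun i => (2 * (i : ℕ) + 1 : ℤ)) B) (j : Fin (2 * m + 1)) :
    HasZeroOneTailSums (fun c => symmetrize B c j) ∧ ∑ c, symmetrize B c j = 1 := by
  have hmiddle : (fun c : Fin (2 * m + 1) => 1 - 2 * ∑ i, B i c) =
      fun c : Fin (2 * m + 1) => (1 - 2 * ((c : ℕ) % 2 : ℤ)) :=
    funext fun c => by rw [hB.col_sum, rangeIndicator_two_mul_val_add_one]
  simp only [symmetrize, of_apply]
  split_ifs
  · exact ⟨hB.row_tailSums _, hB.row_sum _⟩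
  · exact ⟨hB.row_tailSums _, hB.row_sum _⟩
  · rw [hmiddle, ← tailSum_zero, tailSum_one_sub_two_mul_mod_two m (Nat.zero_le _)]
    refine ⟨fun t => ?_, rfl⟩
    rcases le_total t (2 * m + 1) with ht | ht
    · rw [tailSum_one_sub_two_mul_mod_two m ht]
      omega
    · exact .inl (tailSum_of_le _ ht)

theorem IsPartialASM.isVSASM_symmetrize
    (hB : IsPartialASM (fun i => (2 * (i : ℕ) + 1 : ℤ)) B) : IsVSASM (symmetrize B) where
  isASM := isASM_iff_hasZeroOneTailSums.2
    ⟨⟨hB.hasZeroOneTailSums_symmetrize_row, sum_symmetrize_row⟩,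
      fun j => (hB.symmetrize_col j).1, fun j => (hB.symmetrize_col j).2⟩
  symm := symmetrize_rev

theorem bijOn_rightColumns_setOf_isVSASM :
    Set.BijOn rightColumns {A : Matrix (Fin (2 * m + 1)) (Fin (2 * m + 1)) ℤ | IsVSASM A}
      {B : Matrix (Fin m) (Fin (2 * m + 1)) ℤ |
        IsPartialASM (fun i => (2 * (i : ℕ) + 1 : ℤ)) B} := by
  refine Set.InvOn.bijOn (f' := symmetrize) ⟨fun A hA => ?_, fun B _ => rightColumns_symmetrize⟩
    (fun A hA => IsVSASM.isPartialASM_rightColumns hA)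
    fun B hB => IsPartialASM.isVSASM_symmetrize hB
  exact (eq_symmetrize_rightColumns hA.symm hA.isASM.row_sum).symm

theorem leftNegOneCount_eq_negEntryCount_rightColumns (hA : ∀ i j, A i j.rev = A i j) :
    leftNegOneCount A = negEntryCount (rightColumns A) := by
  have hlt (j : Fin (2 * m + 1)) : j < j.rev ↔ (j : ℕ) < m := by
    rw [Fin.lt_def, Fin.val_rev]
    omega
  simp only [leftNegOneCount, negEntryCount, hlt]
  refine (Finset.card_bij (fun p _ => (p.2, (⟨m + 1 + p.1, by omega⟩ : Fin _).rev)) ?_ ?_ ?_).symm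
  · rintro ⟨i, c⟩ hneg
    rw [Finset.mem_filter_univ] at hneg ⊢
    exact ⟨by simp only [Fin.val_rev]; omega, (hA _ _).trans hneg⟩
  · rintro ⟨i, c⟩ _ ⟨i', c'⟩ _ h
    simp only [Prod.mk.injEq, Fin.rev_inj, Fin.mk.injEq] at h
    exact Prod.ext (Fin.ext (by dsimp only; omega)) h.1
  · rintro ⟨c, j⟩ hneg
    rw [Finset.mem_filter_univ] at hneg
    obtain ⟨hjm, hneg⟩ : (j : ℕ) < m ∧ A c j = -1 := hneg
    have hj : (⟨m + 1 + (m - 1 - j), by omega⟩ : Fin (2 * m + 1)) = j.rev :=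
      Fin.ext (by simp only [Fin.val_rev]; omega)
    refine ⟨(⟨m - 1 - j, by omega⟩, c), (Finset.mem_filter_univ _).2 ?_, ?_⟩
    · exact (congrArg (A c) hj).trans ((hA c j).trans hneg)
    · simp only [hj, Fin.rev_rev]

theorem vsasmEnum_two_mul_add_one {R : Type*} [CommSemiring R] (Q : R) (m : ℕ) :
    vsasmEnum Q (2 * m + 1) = monotoneTriangleEnum Q m fun i => 2 * (i : ℕ) + 1 := by
  rw [← finsum_isPartialASM_pow_negEntryCount Q strictMono_two_mul_val_add_one
    two_mul_val_add_one_mem_Ico]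
  exact finsum_mem_eq_of_bijOn rightColumns bijOn_rightColumns_setOf_isVSASM fun A hA =>
    congrArg (Q ^ ·) (leftNegOneCount_eq_negEntryCount_rightColumns hA.symm)

end VSASM

theorem mainTheorem5 :
    (∀ (n : ℕ) (k : Fin n → ℤ), StrictMono k →
      (monotoneTriangles n k).Finite ∧
      monotoneTriangleEnum (2 : ℚ) n k =
        2 ^ n.choose 2 *
          ∏ i : Fin n, ∏ j ∈ Finset.Ioi i,
            ((k j : ℚ) - (k i : ℚ)) / (((j : ℕ) : ℚ) - ((i : ℕ) : ℚ))) ∧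
    (∀ n : ℕ, {A : Matrix (Fin n) (Fin n) ℤ | IsASM A}.Finite ∧
      negOneEnum (2 : ℕ) {A : Matrix (Fin n) (Fin n) ℤ | IsASM A} = 2 ^ n.choose 2) ∧
    (∀ (n l : ℕ) (hl : 1 ≤ l) (hln : l ≤ n),
      negOneEnum (2 : ℕ) {A : Matrix (Fin n) (Fin n) ℤ |
          IsASM A ∧ A ⟨0, by omega⟩ ⟨l - 1, by omega⟩ = 1} =
        2 ^ (n - 1).choose 2 * (n - 1).choose (l - 1)) ∧
    (∀ n : ℕ, 1 ≤ n → vsasmEnum (2 : ℕ) (2 * n - 1) = 2 ^ ((n - 1) * (n - 2))) := by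
  refine ⟨fun n k hk => ⟨finite_monotoneTriangles k, monotoneTriangleEnum_two_eq_prod hk⟩,
    fun n => ⟨finite_setOf_isASM, (negOneEnum_setOf_isASM 2).trans monotoneTriangleEnum_two_val⟩,
    fun n l hl hln => ?_, fun n hn => ?_⟩
  · obtain ⟨m, rfl⟩ : ∃ m, n = m + 1 := ⟨n - 1, by omega⟩
    exact (negOneEnum_setOf_isASM_and_eq_one 2 ⟨l - 1, by omega⟩).trans
      (monotoneTriangleEnum_two_val_succAbove _)
  · obtain ⟨m, rfl⟩ : ∃ m, n = m + 1 := ⟨n - 1, by omega⟩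
    rw [show 2 * (m + 1) - 1 = 2 * m + 1 by omega, vsasmEnum_two_mul_add_one,
      monotoneTriangleEnum_two_two_mul_val_add_one]
    rfl
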